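/- Let $\mathbb T=\mathbb R/2\pi\mathbb Z$ and, for $f\in L^1(\mathbb T)$, let $\hat f(n)=\frac1{2\pi}\int_{-\pi}^{\pi}f(t)e^{-int}\,dt$ $(n\in\mathbb Z)$. Let $A(\mathbb T)=\{f\in L^1(\mathbb T):\|f\|:=\sum_{n\in\mathbb Z}|\hat f(n)|<\infty\}$ be the Fourier algebra of the circle; its elements are identified with their continuous representatives, and it is a complex Banach algebra under pointwise operations and the norm $\|\cdot\|$. For $f\in A(\mathbb T)$ let $\operatorname{supp} f$ be the closure of $\{x\in\mathbb T: f(x)\neq 0\}$. (1) Let $\phi:A(\mathbb T)\times A(\mathbb T)\to\mathbb C$ be a continuous bilinear map and let $\alpha\ge 0$ be such that $$f,g\in A(\mathbb T),\ \operatorname{supp} f\cap\operatorname{supp} g=\emptyset\ \Longrightarrow\ |\phi(f,g)|\le\alpha\|f\|\,\|g\|.$$ Then $$|\phi(fg,h)-\phi(f,gh)|\le 288\pi(1+\sqrt2)\,\alpha\,\|f\|\,\|g\|\,\|h\|\qquad\text{for all } f,g,h\in A(\mathbb T).$$ (2) Consequently $A(\mathbb T)$ has the strong property (B) with the constant $r=288\pi(1+\sqrt2)$.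 Here a complex Banach algebra $A$ has the strong property (B) with a constant $r>0$ if, for every complex Banach space $X$, every bounded bilinear map $\varphi:A\times A\to X$ and every $\alpha\ge0$ such that $\|\varphi(a,b)\|\le\alpha\|a\|\|b\|$ for all $a,b\in A$ with $ab=0$, one has $\|\varphi(ab,c)-\varphi(a,bc)\|\le r\alpha\|a\|\|b\|\|c\|$ for all $a,b,c\in A$. -/

import Mathlib

universe u v

noncomputable section

open MeasureTheory

instance fact_two_pi_pos : Fact ((0 : ℝ) < 2 * Real.pi) := ⟨Real.two_pi_pos⟩

/-- The circle `ℝ / 2πℤ`. -/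
abbrev Torus : Type := AddCircle (2 * Real.pi)

namespace FourierAlgebra

/-- The `n`-th Fourier coefficient as a continuous linear functional on `C(𝕋)`. -/
def coeffCLM (n : ℤ) : C(Torus, ℂ) →L[ℂ] ℂ :=
  LinearMap.mkContinuous
    { toFun := fun f => fourierCoeff (f : Torus → ℂ) n
      map_add' := fun f g => by
        have hf : Integrable (f : Torus → ℂ) AddCircle.haarAddCircle :=
          f.continuous.integrable_of_hasCompactSupport (HasCompactSupport.of_compactSpace _)
        have hg : Integrable (g : Torus → ℂ) AddCircle.haarAddCircle :=
          g.continuous.integrable_of_hasCompactSupport (HasCompactSupport.of_compactSpace _)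
        rw [ContinuousMap.coe_add, fourierCoeff.add hf hg, Pi.add_apply]
      map_smul' := fun c f => by
        rw [ContinuousMap.coe_smul, fourierCoeff.const_smul, RingHom.id_apply] }
    1
    (fun f => by
      change ‖∫ t : Torus, fourier (-n) t • f t ∂AddCircle.haarAddCircle‖ ≤ 1 * ‖f‖
      have := norm_integral_le_of_norm_le_const (μ := (AddCircle.haarAddCircle : Measure Torus))
        (f := fun t : Torus => fourier (-n) t • f t) (C := ‖f‖)
        (Filter.Eventually.of_forall fun t => by
          rw [norm_smul, fourier_apply, Circle.norm_coe, one_mul]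
          exact f.norm_coe_le_norm t)
      simpa using this)

theorem coeffCLM_apply (n : ℤ) (f : C(Torus, ℂ)) :
    coeffCLM n f = fourierCoeff (f : Torus → ℂ) n := rfl

/-- Fourier coefficients of an absolutely convergent sum of characters. -/
theorem hasSum_coeff {ι : Type*} {c : ι → ℂ} {m : ι → ℤ} {F : C(Torus, ℂ)}
    (hF : HasSum (fun i => c i • (fourier (m i) : C(Torus, ℂ))) F) (n : ℤ) :
    HasSum (fun i => if m i = n then c i else 0) (fourierCoeff (F : Torus → ℂ) n) := by
  have h := (coeffCLM n).hasSum hF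
  rw [coeffCLM_apply] at h
  refine h.congr_fun ?_
  intro i
  simp only [map_smul, coeffCLM_apply, fourierCoeff_fourier, smul_eq_mul, Pi.single_apply, eq_comm]
  split_ifs <;> simp

theorem summable_fiber {ι : Type*} {c : ι → ℂ} (m : ι → ℤ) (hc : Summable fun i => ‖c i‖) :
    Summable (fun p : ι × ℤ => if m p.1 = p.2 then ‖c p.1‖ else 0) := by
  rw [summable_prod_of_nonneg (fun p => by dsimp; split_ifs <;> positivity)]
  refine ⟨fun i => (hasSum_ite_eq (m i) ‖c i‖).summable.congr fun n => by simp [eq_comm], ?_⟩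
  refine hc.congr fun i => ?_
  simp [eq_comm]

theorem coeff_sum_bound {ι : Type*} {c : ι → ℂ} {m : ι → ℤ} {F : C(Torus, ℂ)}
    (hc : Summable fun i => ‖c i‖)
    (hF : HasSum (fun i => c i • (fourier (m i) : C(Torus, ℂ))) F) :
    Summable (fun n => ‖fourierCoeff (F : Torus → ℂ) n‖) ∧
      ∑' n, ‖fourierCoeff (F : Torus → ℂ) n‖ ≤ ∑' i, ‖c i‖ := by
  have hs := summable_fiber m hc
  have hs' : Summable (fun p : ℤ × ι => if m p.2 = p.1 then ‖c p.2‖ else 0) :=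
    hs.prod_symm
  have hs2 := hs'.prod
  have hle : ∀ n, ‖fourierCoeff (F : Torus → ℂ) n‖ ≤ ∑' i, if m i = n then ‖c i‖ else 0 := by
    intro n
    rw [← (hasSum_coeff hF n).tsum_eq]
    have hn : ∀ i, ‖(if m i = n then c i else 0 : ℂ)‖ = if m i = n then ‖c i‖ else 0 := by
      intro i; split_ifs <;> simp
    have := norm_tsum_le_tsum_norm (f := fun i => (if m i = n then c i else 0 : ℂ))
      (by simp only [hn]; exact hs'.prod_factor n)
    simpa only [hn] using this
  have hsum := Summable.of_nonneg_of_le (fun n => norm_nonneg _) hle hs2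
  refine ⟨hsum, (hsum.tsum_le_tsum hle hs2).trans (le_of_eq ?_)⟩
  have := Summable.tsum_comm (f := fun (n : ℤ) (i : ι) => if m i = n then ‖c i‖ else 0) hs'
  rw [← this]
  refine tsum_congr fun i => ?_
  simp [eq_comm]

theorem mul_bound {f g : C(Torus, ℂ)}
    (hf : Summable fun n => ‖fourierCoeff (f : Torus → ℂ) n‖)
    (hg : Summable fun n => ‖fourierCoeff (g : Torus → ℂ) n‖) :
    Summable (fun n => ‖fourierCoeff ((f * g : C(Torus, ℂ)) : Torus → ℂ) n‖) ∧
      ∑' n, ‖fourierCoeff ((f * g : C(Torus, ℂ)) : Torus → ℂ) n‖ ≤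
        (∑' n, ‖fourierCoeff (f : Torus → ℂ) n‖) * ∑' n, ‖fourierCoeff (g : Torus → ℂ) n‖ := by
  have hF := hasSum_fourier_series_of_summable hf.of_norm
  have hG := hasSum_fourier_series_of_summable hg.of_norm
  have hc : Summable fun p : ℤ × ℤ =>
      ‖fourierCoeff (f : Torus → ℂ) p.1 * fourierCoeff (g : Torus → ℂ) p.2‖ :=
    Summable.mul_norm hf hg
  have hterm : ∀ p : ℤ × ℤ,
      (fourierCoeff (f : Torus → ℂ) p.1 * fourierCoeff (g : Torus → ℂ) p.2) •
        (fourier (p.1 + p.2) : C(Torus, ℂ)) =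
      (fourierCoeff (f : Torus → ℂ) p.1 • (fourier p.1 : C(Torus, ℂ))) *
        (fourierCoeff (g : Torus → ℂ) p.2 • (fourier p.2 : C(Torus, ℂ))) := by
    intro p
    have : (fourier (p.1 + p.2) : C(Torus, ℂ)) = fourier p.1 * fourier p.2 := by
      ext x
      rw [ContinuousMap.mul_apply, fourier_add]
    rw [this, smul_mul_smul_comm]
  have hsm : Summable fun p : ℤ × ℤ =>
      (fourierCoeff (f : Torus → ℂ) p.1 • (fourier p.1 : C(Torus, ℂ))) *
        (fourierCoeff (g : Torus → ℂ) p.2 • (fourier p.2 : C(Torus, ℂ))) := by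
    simp only [← hterm]
    refine Summable.of_norm ?_
    simpa only [norm_smul, fourier_norm, mul_one] using hc
  have hFG := hF.mul hG hsm
  have key := coeff_sum_bound (m := fun p : ℤ × ℤ => p.1 + p.2) hc (F := f * g)
    (by simpa only [hterm] using hFG)
  refine ⟨key.1, key.2.trans (le_of_eq ?_)⟩
  simp only [norm_mul] at hc ⊢
  exact (hf.tsum_mul_tsum hg hc).symm

/-- The continuous functions on the circle with absolutely summable Fourier coefficients, as a
subalgebra of `C(𝕋)` (pointwise operations). -/
def carrierSubalgebra : Subalgebra ℂ C(Torus, ℂ) where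
  carrier := {f | Summable fun n : ℤ => ‖fourierCoeff (f : Torus → ℂ) n‖}
  mul_mem' hf hg := (mul_bound hf hg).1
  add_mem' {f g} hf hg := by
    refine Summable.of_nonneg_of_le (fun n => norm_nonneg _) (fun n => ?_) (hf.add hg)
    rw [← coeffCLM_apply, map_add]
    exact norm_add_le _ _
  algebraMap_mem' r := by
    have h : HasSum (fun _ : Unit => r • (fourier 0 : C(Torus, ℂ)))
        (algebraMap ℂ C(Torus, ℂ) r) := by
      convert hasSum_unique (fun _ : Unit => r • (fourier 0 : C(Torus, ℂ))) using 1
      ext x; simp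
    exact (coeff_sum_bound (c := fun _ : Unit => r) (m := fun _ => 0) (Summable.of_finite) h).1

end FourierAlgebra

open FourierAlgebra

/-- The Fourier algebra `A(𝕋)`: functions on the circle whose Fourier coefficients are absolutely
summable, each represented by its continuous representative, with pointwise operations. It is a
separate type so that it does not inherit the supremum norm. -/
def FourierAlgebra : Type := carrierSubalgebra

namespace FourierAlgebra

instance : CommRing FourierAlgebra := inferInstanceAs (CommRing carrierSubalgebra)

instance : Algebra ℂ FourierAlgebra := inferInstanceAs (Algebra ℂ carrierSubalgebra)

/-- The inclusion `A(𝕋) → C(𝕋)`. -/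
def toC : FourierAlgebra →ₐ[ℂ] C(Torus, ℂ) := carrierSubalgebra.val

instance : CoeFun FourierAlgebra (fun _ => Torus → ℂ) := ⟨fun f => toC f⟩

theorem toC_injective : Function.Injective toC := Subtype.val_injective

theorem summable_coeff (f : FourierAlgebra) :
    Summable fun n : ℤ => ‖fourierCoeff (f : Torus → ℂ) n‖ := f.2

/-- `‖f‖ = ∑ₙ |f̂(n)|`. -/
instance : Norm FourierAlgebra := ⟨fun f => ∑' n : ℤ, ‖fourierCoeff (f : Torus → ℂ) n‖⟩

theorem norm_def (f : FourierAlgebra) :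
    ‖f‖ = ∑' n : ℤ, ‖fourierCoeff (f : Torus → ℂ) n‖ := rfl

theorem norm_eq (f : FourierAlgebra) : ‖f‖ = ∑' n : ℤ, ‖coeffCLM n (toC f)‖ := rfl

instance : NormedAddCommGroup FourierAlgebra :=
  AddGroupNorm.toNormedAddCommGroup
    { toFun := fun f => ‖f‖
      map_zero' := by simp [norm_eq]
      add_le' := fun f g => by
        have hf : Summable fun n => ‖coeffCLM n (toC f)‖ := summable_coeff f
        have hg : Summable fun n => ‖coeffCLM n (toC g)‖ := summable_coeff g
        have hfg : Summable fun n => ‖coeffCLM n (toC (f + g))‖ := summable_coeff (f + g)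
        simp only [norm_eq]
        rw [← hf.tsum_add hg]
        refine hfg.tsum_le_tsum (fun n => ?_) (hf.add hg)
        rw [map_add, map_add]
        exact norm_add_le _ _
      neg' := fun f => by simp [norm_eq]
      eq_zero_of_map_eq_zero' := fun f h => by
        have h0 : ∀ n, fourierCoeff (f : Torus → ℂ) n = 0 := by
          intro n
          have := (hasSum_zero_iff_of_nonneg (fun n => norm_nonneg _)).1
            ((show ∑' n : ℤ, ‖fourierCoeff (f : Torus → ℂ) n‖ = 0 from h) ▸
              (summable_coeff f).hasSum)
          simpa using congrFun this n
        apply toC_injective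
        have hs := hasSum_fourier_series_of_summable (summable_coeff f).of_norm
        simp only [h0, zero_smul] at hs
        rw [map_zero]
        exact hs.unique hasSum_zero }

instance : NormedCommRing FourierAlgebra :=
  { (inferInstance : NormedAddCommGroup FourierAlgebra),
    (inferInstance : CommRing FourierAlgebra) with
    norm_mul_le := fun f g => (mul_bound (summable_coeff f) (summable_coeff g)).2 }

instance : NormedAlgebra ℂ FourierAlgebra :=
  { (inferInstance : Algebra ℂ FourierAlgebra) with
    norm_smul_le := fun c f => by
      simp only [norm_eq, map_smul, norm_smul]
      rw [tsum_mul_left] }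

/-- An absolutely summable sequence is the sequence of Fourier coefficients of some element. -/
theorem exists_coeff_eq {a : ℤ → ℂ} (ha : Summable fun n => ‖a n‖) :
    ∃ f : FourierAlgebra, ∀ n, fourierCoeff (f : Torus → ℂ) n = a n := by
  have hs : Summable fun n => a n • (fourier n : C(Torus, ℂ)) :=
    Summable.of_norm (by simpa only [norm_smul, fourier_norm, mul_one] using ha)
  refine ⟨⟨∑' n, a n • (fourier n : C(Torus, ℂ)),
    (coeff_sum_bound (m := fun n => n) ha hs.hasSum).1⟩, fun n => ?_⟩
  refine (hasSum_coeff (m := fun n => n) hs.hasSum n).unique ?_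
  convert hasSum_ite_eq n (a n) using 2 with k
  split_ifs with h
  · rw [h]
  · rfl

/-- The Fourier transform as an isometry onto `ℓ¹(ℤ)`. -/
def toL1 (f : FourierAlgebra) : lp (fun _ : ℤ => ℂ) 1 :=
  ⟨fourierCoeff (f : Torus → ℂ), memℓp_gen (by simpa using summable_coeff f)⟩

theorem isometry_toL1 : Isometry toL1 := by
  refine Isometry.of_dist_eq fun f g => ?_
  rw [dist_eq_norm, dist_eq_norm, lp.norm_eq_tsum_rpow (by simp), norm_eq]
  simp only [ENNReal.toReal_one, Real.rpow_one, div_one, map_sub]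
  rfl

theorem surjective_toL1 : Function.Surjective toL1 := by
  intro a
  obtain ⟨f, hf⟩ := exists_coeff_eq (a := a) (by simpa using a.2.summable (by simp))
  exact ⟨f, Subtype.ext (funext hf)⟩

instance : CompleteSpace FourierAlgebra := by
  rw [completeSpace_iff_isComplete_range isometry_toL1.isUniformInducing,
    surjective_toL1.range_eq]
  exact completeSpace_iff_isComplete_univ.1 inferInstance

/-- The support of `f ∈ A(𝕋)`: the closure of `{x | f x ≠ 0}`. -/
def supp (f : FourierAlgebra) : Set Torus := tsupport (f : Torus → ℂ)

/-- Restricting to continuous functions loses nothing: every `f ∈ L¹(𝕋)` with absolutely summable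
Fourier coefficients agrees almost everywhere with an element of `A(𝕋)`. -/
theorem exists_ae_eq {f : Torus → ℂ} (hf : Integrable f AddCircle.haarAddCircle)
    (hs : Summable fun n : ℤ => ‖fourierCoeff f n‖) :
    ∃ g : FourierAlgebra, f =ᵐ[AddCircle.haarAddCircle] (g : Torus → ℂ) := by
  obtain ⟨g, hg⟩ := exists_coeff_eq hs
  refine ⟨g, ?_⟩
  have hgi : Integrable (g : Torus → ℂ) AddCircle.haarAddCircle :=
    (toC g).continuous.integrable_of_hasCompactSupport (HasCompactSupport.of_compactSpace _)
  set h : Torus → ℂ := fun t => f t - g t with hh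
  have hi : Integrable h AddCircle.haarAddCircle := hf.sub hgi
  -- `h` annihilates every character
  have h0 : ∀ n : ℤ, ∫ t, fourier n t * h t ∂AddCircle.haarAddCircle = 0 := by
    intro n
    have e : ∫ t, (fourier n t • f t - fourier n t • g t) ∂AddCircle.haarAddCircle = 0 := by
      rw [integral_sub (hf.fourier_smul n) (hgi.fourier_smul n), sub_eq_zero]
      have := hg (-n)
      simp only [fourierCoeff, neg_neg] at this
      exact this.symm
    simpa only [hh, smul_eq_mul, mul_sub] using e
  -- hence every continuous function
  have hmul : ∀ u : C(Torus, ℂ), Integrable (fun t => u t * h t) AddCircle.haarAddCircle :=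
    fun u => hi.bdd_mul u.continuous.aestronglyMeasurable
      (Filter.Eventually.of_forall fun t => u.norm_coe_le_norm t)
  let L : C(Torus, ℂ) →L[ℂ] ℂ := LinearMap.mkContinuous
    { toFun := fun u => ∫ t, u t * h t ∂AddCircle.haarAddCircle
      map_add' := fun u v => by
        rw [← integral_add (hmul u) (hmul v)]
        simp only [ContinuousMap.add_apply, add_mul]
      map_smul' := fun c u => by
        simp only [ContinuousMap.smul_apply, smul_eq_mul, mul_assoc, integral_const_mul,
          RingHom.id_apply] }
    (∫ t, ‖h t‖ ∂AddCircle.haarAddCircle)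
    (fun u => by
      refine (norm_integral_le_of_norm_le (hi.norm.mul_const ‖u‖)
        (Filter.Eventually.of_forall fun t => ?_)).trans_eq (integral_mul_const _ _)
      rw [norm_mul, mul_comm]
      exact mul_le_mul_of_nonneg_left (u.norm_coe_le_norm t) (norm_nonneg _))
  have hL : ∀ u, L u = 0 := by
    have hle : (Submodule.span ℂ (Set.range (@fourier (2 * Real.pi)))).topologicalClosure
        ≤ LinearMap.ker L.toLinearMap := by
      refine Submodule.topologicalClosure_minimal _ ?_ L.isClosed_ker
      rw [Submodule.span_le]
      rintro _ ⟨n, rfl⟩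
      exact h0 n
    rw [span_fourier_closure_eq_top] at hle
    exact fun u => hle Submodule.mem_top
  have hzero : h =ᵐ[AddCircle.haarAddCircle] 0 := by
    refine ae_eq_zero_of_forall_setIntegral_isClosed_eq_zero hi fun K hK => ?_
    obtain ⟨δ, -, hδ, hlim⟩ := exists_seq_strictAnti_tendsto (0 : ℝ)
    have hT := thickenedIndicator_tendsto_indicator_closure hδ hlim K
    rw [hK.closure_eq, tendsto_pi_nhds] at hT
    rw [← integral_indicator hK.measurableSet]
    refine tendsto_nhds_unique (tendsto_integral_of_dominated_convergence
      (F := fun n t => (((thickenedIndicator (hδ n) K t : NNReal) : ℝ) : ℂ) * h t)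
      (fun t => ‖h t‖) (fun n => ?_) hi.norm (fun n => ?_) ?_) ?_
    · exact (Complex.continuous_ofReal.comp (NNReal.continuous_coe.comp
        (thickenedIndicator (hδ n) K).continuous)).aestronglyMeasurable.mul
        hi.aestronglyMeasurable
    · refine Filter.Eventually.of_forall fun t => ?_
      rw [norm_mul, Complex.norm_real, Real.norm_of_nonneg (NNReal.coe_nonneg _)]
      exact mul_le_of_le_one_left (norm_nonneg _)
        (by exact_mod_cast thickenedIndicator_le_one (hδ n) K t)
    · refine Filter.Eventually.of_forall fun t => ?_
      have h1 := ((Complex.continuous_ofReal.comp NNReal.continuous_coe).tendsto _).comp (hT t)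
      have h2 := h1.mul_const (h t)
      have e : K.indicator h t = (Complex.ofReal ∘ NNReal.toReal)
          (K.indicator (fun _ => (1 : NNReal)) t) * h t := by
        by_cases ht : t ∈ K <;> simp [ht]
      rw [e]
      exact h2
    · have : ∀ n, ∫ t, (((thickenedIndicator (hδ n) K t : NNReal) : ℝ) : ℂ) * h t
          ∂AddCircle.haarAddCircle = 0 := fun n =>
        hL ⟨fun t => (((thickenedIndicator (hδ n) K t : NNReal) : ℝ) : ℂ),
          Complex.continuous_ofReal.comp (NNReal.continuous_coe.comp
            (thickenedIndicator (hδ n) K).continuous)⟩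
      simp only [this]
      exact tendsto_const_nhds
  filter_upwards [hzero] with t ht
  exact sub_eq_zero.1 ht

end FourierAlgebra

/-- A (not necessarily unital) complex Banach algebra `A` has the strong property (B) with constant
`r > 0`: for every Banach space `X` and bounded bilinear `φ : A × A → X` with
`‖φ(a, b)‖ ≤ α‖a‖‖b‖` whenever `ab = 0`, one has
`‖φ(ab, c) - φ(a, bc)‖ ≤ rα‖a‖‖b‖‖c‖` for all `a, b, c`. -/
def HasStrongPropertyB (A : Type v) [NonUnitalNormedRing A] [NormedSpace ℂ A]
    [IsScalarTower ℂ A A] [SMulCommClass ℂ A A] [CompleteSpace A] (r : ℝ) : Prop :=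
  0 < r ∧
  ∀ (X : Type u) [NormedAddCommGroup X] [NormedSpace ℂ X] [CompleteSpace X]
    (φ : A →L[ℂ] A →L[ℂ] X) (α : ℝ), 0 ≤ α →
    (∀ a b : A, a * b = 0 → ‖φ a b‖ ≤ α * ‖a‖ * ‖b‖) →
    ∀ a b c : A, ‖φ (a * b) c - φ a (b * c)‖ ≤ r * α * ‖a‖ * ‖b‖ * ‖c‖

end

noncomputable section

open MeasureTheory

namespace FourierAlgebra

/-! ### Characters and functionals on the Fourier algebra -/

/-! `A(𝕋)` is isometric to `ℓ¹(ℤ)`, with characters `e_n` corresponding to the unit vectors, so a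
bound for a multilinear map need only be checked on characters (`norm_le_of_norm_chr_le`). For `f,
g, h = e_a, e_b, e_c` the quantity to bound is the value at `e_1 - e_0` of the functional `diag ψ' 1
1 : w ↦ ∑ ŵ(n) ψ'(e_n, e_{-n})`, where `ψ'(f, g) = ψ(e_a f(b·), e_{b+c} g(b·))`. Formally this pairs
`ψ'` with `w(x - y)`. Passing from `ψ` to `ψ'` preserves the hypothesis.

If `w` vanishes near `0`, then `w(x - y)` lives off the diagonal. A partition of unity into 16 hats
separates `x` from `y`, and disjointness of supports gives `‖diag ψ 1 1 w‖ ≤ 96 α ‖w‖`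
(`norm_diag_le`).

Since `e_1 - e_0` does not vanish near `0`, scaling is used. The class of admissible forms is stable
under dilations and twists, so an identity expressing a function through its dilates, with
coefficients of total size less than `1`, plus a controlled remainder bounds the supremum over the
class. Three such identities are used: `|s|` equals half its dilate by `2` near `0`; in the cosine
series of `|s|` the term `1 - cos s` outweighs all the others together, which are dilates of it; and
`e^{is} - 1 = (e^{2is} - 1)/2 + e^{is}(1 - cos s)`.

For values in a Banach space, compose with a norming functional. -/

theorem coeffCLM_fourier (n k : ℤ) :
    coeffCLM k (fourier n : C(Torus, ℂ)) = if k = n then 1 else 0 := by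
  rw [coeffCLM_apply, fourierCoeff_fourier, Pi.single_apply]

/-- The character `x ↦ e^{inx}` as an element of `A(𝕋)`. -/
def chr (n : ℤ) : FourierAlgebra :=
  ⟨fourier n, by
    change Summable fun k : ℤ => ‖coeffCLM k (fourier n : C(Torus, ℂ))‖
    simp only [coeffCLM_fourier]
    refine (hasSum_ite_eq n (1 : ℝ)).summable.congr fun k => ?_
    split_ifs <;> simp⟩

theorem toC_chr (n : ℤ) : toC (chr n) = fourier n := rfl

theorem norm_chr (n : ℤ) : ‖chr n‖ = 1 := by
  rw [norm_eq]
  simp only [toC_chr, coeffCLM_fourier]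
  rw [← (hasSum_ite_eq n (1 : ℝ)).tsum_eq]
  refine tsum_congr fun k => ?_
  split_ifs <;> simp

theorem chr_add (m n : ℤ) : chr (m + n) = chr m * chr n := by
  apply toC_injective
  ext x
  simp only [map_mul, toC_chr, ContinuousMap.mul_apply, fourier_add]

theorem chr_zero : chr 0 = 1 := by
  apply toC_injective
  ext x
  simp [toC_chr]

theorem summable_norm_coeffCLM (f : FourierAlgebra) :
    Summable fun n => ‖coeffCLM n (toC f)‖ := summable_coeff f

theorem norm_toC_le (f : FourierAlgebra) : ‖toC f‖ ≤ ‖f‖ := by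
  have h := hasSum_fourier_series_of_summable (summable_coeff f).of_norm
  refine h.norm_le_of_bounded (summable_coeff f).hasSum fun n => ?_
  rw [norm_smul, fourier_norm, mul_one]

/-- The inclusion `A(𝕋) → C(𝕋)` as a continuous linear map. -/
def toCL : FourierAlgebra →L[ℂ] C(Torus, ℂ) :=
  toC.toLinearMap.mkContinuous 1 fun f => by simpa using norm_toC_le f

theorem toCL_apply (f : FourierAlgebra) : toCL f = toC f := rfl

/-- Point evaluation on `A(𝕋)`. -/
def evalCL (x : Torus) : FourierAlgebra →L[ℂ] ℂ :=
  (ContinuousMap.evalCLM ℂ x).comp toCL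

theorem evalCL_apply (x : Torus) (f : FourierAlgebra) : evalCL x f = f x := rfl

section Lift

variable {E : Type*} [NormedAddCommGroup E] [NormedSpace ℂ E] [CompleteSpace E]

theorem summable_coeff_smul {a : ℤ → E} {B : ℝ} (ha : ∀ n, ‖a n‖ ≤ B) (f : FourierAlgebra) :
    Summable fun n => coeffCLM n (toC f) • a n := by
  refine Summable.of_norm_bounded ((summable_norm_coeffCLM f).mul_right B) fun n => ?_
  rw [norm_smul]
  exact mul_le_mul_of_nonneg_left (ha n) (norm_nonneg _)

/-- The continuous linear map on `A(𝕋)` sending the `n`-th character to `a n`, for a bounded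
family `a`. -/
def lift (a : ℤ → E) (B : ℝ) (ha : ∀ n, ‖a n‖ ≤ B) : FourierAlgebra →L[ℂ] E :=
  LinearMap.mkContinuous
    { toFun := fun f => ∑' n, coeffCLM n (toC f) • a n
      map_add' := fun f g => by
        rw [← (summable_coeff_smul ha f).tsum_add (summable_coeff_smul ha g)]
        simp only [map_add, add_smul]
      map_smul' := fun c f => by
        simp only [map_smul, smul_eq_mul, mul_smul, RingHom.id_apply]
        rw [(summable_coeff_smul ha f).tsum_const_smul] }
    B (fun f => by
      rw [norm_eq, mul_comm B]
      refine tsum_of_norm_bounded ((summable_norm_coeffCLM f).hasSum.mul_right B) fun n => ?_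
      rw [norm_smul]
      exact mul_le_mul_of_nonneg_left (ha n) (norm_nonneg _))

theorem hasSum_lift {a : ℤ → E} {B : ℝ} (ha : ∀ n, ‖a n‖ ≤ B) (f : FourierAlgebra) :
    HasSum (fun n => coeffCLM n (toC f) • a n) (lift a B ha f) :=
  (summable_coeff_smul ha f).hasSum

theorem lift_chr {a : ℤ → E} {B : ℝ} (ha : ∀ n, ‖a n‖ ≤ B) (n : ℤ) :
    lift a B ha (chr n) = a n := by
  refine (hasSum_lift ha (chr n)).unique ?_
  refine (hasSum_ite_eq n (a n)).congr_fun fun k => ?_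
  rw [toC_chr, coeffCLM_fourier]
  split_ifs with h
  · rw [h, one_smul]
  · rw [zero_smul]

end Lift

/-- The Fourier series of `f ∈ A(𝕋)` converges to `f` in the norm of `A(𝕋)`. -/
theorem hasSum_chr (f : FourierAlgebra) : HasSum (fun n => coeffCLM n (toC f) • chr n) f := by
  have h := hasSum_lift (a := chr) (B := 1) (fun n => (norm_chr n).le) f
  have e : lift chr 1 (fun n => (norm_chr n).le) f = f := by
    apply toC_injective
    refine HasSum.unique ?_ (hasSum_fourier_series_of_summable (summable_coeff f).of_norm)
    simpa only [map_smul, toCL_apply, toC_chr, coeffCLM_apply] using toCL.hasSum h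
  rw [e] at h
  exact h

theorem hasSum_apply (f : FourierAlgebra) (x : Torus) :
    HasSum (fun n => coeffCLM n (toC f) * fourier n x) (f x) := by
  simpa only [map_smul, evalCL_apply, toC_chr, smul_eq_mul] using (evalCL x).hasSum (hasSum_chr f)

/-- The norm is the `ℓ¹` norm of the coefficients, so the unit ball is generated by the characters.
With `C = 0` this also serves as a uniqueness principle for continuous linear maps. -/
theorem norm_le_of_norm_chr_le {E : Type*} [NormedAddCommGroup E] [NormedSpace ℂ E]
    (T : FourierAlgebra →L[ℂ] E) {C : ℝ} (hT : ∀ n, ‖T (chr n)‖ ≤ C) (f : FourierAlgebra) :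
    ‖T f‖ ≤ C * ‖f‖ := by
  have h := T.hasSum (hasSum_chr f)
  rw [norm_eq, mul_comm]
  refine h.norm_le_of_bounded ((summable_norm_coeffCLM f).hasSum.mul_right C) fun n => ?_
  rw [map_smul, norm_smul]
  exact mul_le_mul_of_nonneg_left (hT n) (norm_nonneg _)

/-- The dilation `f ↦ f(N ·)`. -/
def dilate (N : ℤ) : FourierAlgebra →L[ℂ] FourierAlgebra :=
  lift (fun n => chr (N * n)) 1 fun _ => (norm_chr _).le

theorem dilate_chr (N n : ℤ) : dilate N (chr n) = chr (N * n) := lift_chr _ n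

theorem norm_dilate_le (N : ℤ) (f : FourierAlgebra) : ‖dilate N f‖ ≤ ‖f‖ := by
  simpa using norm_le_of_norm_chr_le (dilate N) (C := 1)
    (fun n => by rw [dilate_chr, norm_chr]) f

theorem dilate_apply (N : ℤ) (f : FourierAlgebra) (x : Torus) : dilate N f x = f (N • x) := by
  have h := (evalCL x).hasSum (hasSum_lift (a := fun n => chr (N * n)) (B := 1)
    (fun n => (norm_chr _).le) f)
  refine h.unique ((hasSum_apply f (N • x)).congr_fun fun n => ?_)
  simp only [map_smul, evalCL_apply, toC_chr, smul_eq_mul, fourier_apply, smul_smul, mul_comm]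

theorem norm_fourier_smul_chr (y : Torus) (m n : ℤ) : ‖(fourier m y : ℂ) • chr n‖ = 1 := by
  rw [norm_smul, norm_chr, mul_one, fourier_apply, Circle.norm_coe]

/-- The translation `f ↦ f(· - y)`. -/
def translate (y : Torus) : FourierAlgebra →L[ℂ] FourierAlgebra :=
  lift (fun n => (fourier (-n) y : ℂ) • chr n) 1 fun n => (norm_fourier_smul_chr y (-n) n).le

theorem hasSum_translate (y : Torus) (f : FourierAlgebra) :
    HasSum (fun n => coeffCLM n (toC f) • (fourier (-n) y : ℂ) • chr n) (translate y f) :=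
  hasSum_lift _ f

theorem norm_translate_le (y : Torus) (f : FourierAlgebra) : ‖translate y f‖ ≤ ‖f‖ := by
  simpa using norm_le_of_norm_chr_le (translate y) (C := 1)
    (fun n => by rw [translate, lift_chr]; exact (norm_fourier_smul_chr y (-n) n).le) f

theorem translate_apply (y : Torus) (f : FourierAlgebra) (x : Torus) :
    translate y f x = f (x - y) := by
  refine ((evalCL x).hasSum (hasSum_translate y f)).unique
    ((hasSum_apply f (x - y)).congr_fun fun n => ?_)
  have e : (fourier n (x - y) : ℂ) = fourier (-n) y * fourier n x := by
    rw [fourier_apply, fourier_apply, fourier_apply, ← Circle.coe_mul, ← AddCircle.toCircle_add,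
      smul_sub, neg_smul, neg_add_eq_sub]
  rw [map_smul, map_smul, evalCL_apply, toC_chr, e, smul_eq_mul, smul_eq_mul]

theorem supp_dilate_subset (N : ℤ) (f : FourierAlgebra) :
    (dilate N f).supp ⊆ (fun x => N • x) ⁻¹' f.supp := by
  have : ((dilate N f : FourierAlgebra) : Torus → ℂ) = (f : Torus → ℂ) ∘ (fun x => N • x) :=
    funext fun x => dilate_apply N f x
  rw [supp, this]
  exact tsupport_comp_subset_preimage _ (continuous_zsmul N)

theorem supp_mul_subset_right (f g : FourierAlgebra) : (f * g).supp ⊆ g.supp := by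
  have : ((f * g : FourierAlgebra) : Torus → ℂ) = fun x => f x * g x := by
    funext x; simp only [map_mul, ContinuousMap.mul_apply]
  rw [supp, this]
  exact tsupport_mul_subset_right

theorem supp_mul_subset_left (f g : FourierAlgebra) : (f * g).supp ⊆ f.supp := by
  rw [mul_comm]
  exact supp_mul_subset_right g f

theorem mul_eq_zero_of_supp_disjoint {f g : FourierAlgebra} (h : f.supp ∩ g.supp = ∅) :
    f * g = 0 := by
  apply toC_injective
  ext x
  rw [map_mul, ContinuousMap.mul_apply, map_zero, ContinuousMap.zero_apply]
  by_contra hx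
  rw [mul_eq_zero, not_or] at hx
  have : x ∈ f.supp ∩ g.supp := ⟨subset_tsupport _ hx.1, subset_tsupport _ hx.2⟩
  simp [h] at this

/-! ### The diagonal functional of a bilinear form -/

theorem coeffCLM_mul_chr (v : FourierAlgebra) (n p : ℤ) :
    coeffCLM p (toC (v * chr n)) = coeffCLM (p - n) (toC v) := by
  simp only [coeffCLM_apply, fourierCoeff, map_mul, toC_chr, ContinuousMap.mul_apply, smul_eq_mul]
  refine integral_congr_ae (Filter.Eventually.of_forall fun t => ?_)
  have : -(p - n) = -p + n := by ring
  simp only [this, fourier_add]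
  ring

theorem norm_mul_chr_le (v : FourierAlgebra) (n : ℤ) : ‖v * chr n‖ ≤ ‖v‖ := by
  simpa [norm_chr] using norm_mul_le v (chr n)

theorem norm_apply_mul_chr_le (ψ : FourierAlgebra →L[ℂ] FourierAlgebra →L[ℂ] ℂ)
    (v t : FourierAlgebra) (m n : ℤ) : ‖ψ (v * chr m) (t * chr n)‖ ≤ ‖ψ‖ * ‖v‖ * ‖t‖ :=
  (ψ.le_opNorm₂ _ _).trans <| mul_le_mul
    (mul_le_mul_of_nonneg_left (norm_mul_chr_le v m) (by positivity)) (norm_mul_chr_le t n)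
    (norm_nonneg _) (by positivity)

/-- The functional `w ↦ ∑ₙ ŵ(n) ψ(v eₙ, t e₋ₙ)`, that is, the pairing of `ψ` with the function
`(x, y) ↦ v(x) t(y) w(x - y)`. -/
def diag (ψ : FourierAlgebra →L[ℂ] FourierAlgebra →L[ℂ] ℂ) (v t : FourierAlgebra) :
    FourierAlgebra →L[ℂ] ℂ :=
  lift (fun n => ψ (v * chr n) (t * chr (-n))) (‖ψ‖ * ‖v‖ * ‖t‖)
    fun n => norm_apply_mul_chr_le ψ v t n (-n)

theorem diag_chr (ψ : FourierAlgebra →L[ℂ] FourierAlgebra →L[ℂ] ℂ) (v t : FourierAlgebra)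
    (n : ℤ) : diag ψ v t (chr n) = ψ (v * chr n) (t * chr (-n)) := lift_chr _ n

/-- Expanding `v e_n = ∑ v̂(p - n) e_p` and exchanging sums turns the pairing into `∑ ψ(e_p, t
H_p)`, where `H_p(y)` is the `p`-th Fourier coefficient of `v · w(· - y)`. That product is zero
whenever `t y ≠ 0`, so every `t H_p` vanishes. -/
theorem diag_apply_eq_zero (ψ : FourierAlgebra →L[ℂ] FourierAlgebra →L[ℂ] ℂ)
    {v t w : FourierAlgebra} (h : ∀ x y, v x ≠ 0 → t y ≠ 0 → w (x - y) = 0) :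
    diag ψ v t w = 0 := by
  have hbd : ∀ p n : ℤ, ‖coeffCLM (p - n) (toC v)‖ ≤ ‖v‖ := fun p n =>
    (summable_norm_coeffCLM v).le_tsum (p - n) fun _ _ => norm_nonneg _
  have hbd' : ∀ p n : ℤ, ‖coeffCLM (p - n) (toC v) • chr (-n)‖ ≤ ‖v‖ := fun p n => by
    rw [norm_smul, norm_chr, mul_one]
    exact hbd p n
  set H : ℤ → FourierAlgebra := fun p =>
    lift (fun n => coeffCLM (p - n) (toC v) • chr (-n)) ‖v‖ (hbd' p) w with hH
  have hHsum : ∀ p, HasSum (fun n => coeffCLM n (toC w) • coeffCLM (p - n) (toC v) • chr (-n))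
      (H p) := fun p => hasSum_lift (hbd' p) w
  have hzero : ∀ p, t * H p = 0 := by
    intro p
    apply toC_injective
    ext y
    rw [map_mul, ContinuousMap.mul_apply, map_zero, ContinuousMap.zero_apply]
    by_cases hy : t y = 0
    · rw [hy, zero_mul]
    have hwys := hasSum_translate y w
    set wy : FourierAlgebra := translate y w with hwy
    have hvw : v * wy = 0 := by
      apply toC_injective
      ext x
      rw [map_mul, ContinuousMap.mul_apply, map_zero, ContinuousMap.zero_apply, hwy,
        translate_apply, mul_eq_zero]
      by_cases hx : v x = 0
      · exact Or.inl hx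
      · exact Or.inr (h x y hx hy)
    have h1 : HasSum (fun n => coeffCLM n (toC w) * (coeffCLM (p - n) (toC v) * fourier (-n) y))
        (H p y) := by
      simpa only [map_smul, evalCL_apply, toC_chr, smul_eq_mul] using (evalCL y).hasSum (hHsum p)
    have h2 := ((coeffCLM p).comp toCL).hasSum (hwys.mul_left v)
    rw [hvw, map_zero] at h2
    have : H p y = 0 := by
      refine h1.unique (h2.congr_fun fun n => ?_)
      simp only [mul_smul_comm, map_smul, ContinuousLinearMap.comp_apply, toCL_apply,
        coeffCLM_mul_chr, smul_eq_mul]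
      ring
    rw [this, mul_zero]
  set F : ℤ → ℤ → ℂ := fun n p =>
    coeffCLM n (toC w) * (coeffCLM (p - n) (toC v) * ψ (chr p) (t * chr (-n))) with hF
  have hsumm : Summable (Function.uncurry F) := by
    have hs : Summable fun q : ℤ × ℤ => ‖coeffCLM q.1 (toC w) * coeffCLM q.2 (toC v)‖ :=
      Summable.mul_norm (f := fun n => coeffCLM n (toC w)) (g := fun n => coeffCLM n (toC v))
        (summable_norm_coeffCLM w) (summable_norm_coeffCLM v)
    -- The shear `(n, p) ↦ (n, p - n)` reduces absolute convergence to that of a product of two `ℓ¹`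
    -- sequences.
    let e : ℤ × ℤ ≃ ℤ × ℤ :=
      { toFun := fun q => (q.1, q.2 - q.1)
        invFun := fun q => (q.1, q.2 + q.1)
        left_inv := fun q => by simp
        right_inv := fun q => by simp }
    refine Summable.of_norm_bounded ((e.summable_iff.2 hs).mul_right (‖ψ‖ * 1 * ‖t‖)) ?_
    rintro ⟨n, p⟩
    change ‖F n p‖ ≤ ‖coeffCLM n (toC w) * coeffCLM (p - n) (toC v)‖ * _
    have := norm_apply_mul_chr_le ψ 1 t p (-n)
    rw [one_mul, ← chr_zero, norm_chr] at this
    have e : F n p = coeffCLM n (toC w) * coeffCLM (p - n) (toC v) *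
        ψ (chr p) (t * chr (-n)) := (mul_assoc _ _ _).symm
    rw [e, norm_mul _ (ψ (chr p) (t * chr (-n)))]
    exact mul_le_mul_of_nonneg_left this (norm_nonneg _)
  have hrow : ∀ n, ∑' p, F n p = coeffCLM n (toC w) • ψ (v * chr n) (t * chr (-n)) := by
    intro n
    have := (ContinuousLinearMap.flip ψ (t * chr (-n))).hasSum (hasSum_chr (v * chr n))
    simp only [map_smul, coeffCLM_mul_chr, ContinuousLinearMap.flip_apply, smul_eq_mul] at this
    rw [smul_eq_mul]
    exact (this.mul_left (coeffCLM n (toC w))).tsum_eq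
  have hcol : ∀ p, ∑' n, F n p = 0 := by
    intro p
    have := (ψ (chr p)).hasSum ((hHsum p).mul_left t)
    simp only [mul_smul_comm, map_smul, smul_eq_mul, hzero, map_zero] at this
    exact this.tsum_eq
  rw [diag, ← (hasSum_lift (fun n => norm_apply_mul_chr_le ψ v t n (-n)) w).tsum_eq]
  simp only [← hrow]
  rw [← Summable.tsum_comm hsumm]
  simp only [hcol, tsum_zero]

/-- `ψ` is bounded by `α` on pairs with disjoint supports. -/
def DisjointBound (α : ℝ) (ψ : FourierAlgebra →L[ℂ] FourierAlgebra →L[ℂ] ℂ) : Prop :=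
  ∀ f g : FourierAlgebra, f.supp ∩ g.supp = ∅ → ‖ψ f g‖ ≤ α * ‖f‖ * ‖g‖

/-- The part of `1 = (1 - t) + t` coming from `t` contributes nothing, and `v`, `1 - t` have
disjoint supports. Multiplying them by characters changes neither this nor the norm bounds. -/
theorem norm_diag_one_right_le {α : ℝ} (hα : 0 ≤ α)
    {ψ : FourierAlgebra →L[ℂ] FourierAlgebra →L[ℂ] ℂ} (hψ : DisjointBound α ψ)
    {v t w : FourierAlgebra} (h : ∀ x y, v x ≠ 0 → t y ≠ 0 → w (x - y) = 0)
    (hvt : v.supp ∩ (1 - t).supp = ∅) :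
    ‖diag ψ v 1 w‖ ≤ α * ‖v‖ * ‖1 - t‖ * ‖w‖ := by
  have e : diag ψ v 1 w = diag ψ v (1 - t) w + diag ψ v t w := by
    rw [← _root_.add_apply]
    have : diag ψ v 1 - (diag ψ v (1 - t) + diag ψ v t) = 0 := by
      ext f
      have := norm_le_of_norm_chr_le (diag ψ v 1 - (diag ψ v (1 - t) + diag ψ v t)) (C := 0)
        (fun n => by
          simp only [_root_.sub_apply, _root_.add_apply, diag_chr]
          rw [← map_add, ← add_mul, sub_add_cancel, sub_self, norm_zero]) f
      rw [zero_mul] at this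
      exact norm_le_zero_iff.1 this
    rw [sub_eq_zero.1 this]
  rw [e, diag_apply_eq_zero ψ h, add_zero]
  refine norm_le_of_norm_chr_le _ (fun n => ?_) w
  rw [diag_chr]
  refine (hψ _ _ ?_).trans ?_
  · rw [← Set.subset_empty_iff, ← hvt]
    exact Set.inter_subset_inter (supp_mul_subset_left _ _) (supp_mul_subset_left _ _)
  · gcongr
    · exact norm_mul_chr_le v n
    · exact norm_mul_chr_le _ _

theorem diag_sum_left (ψ : FourierAlgebra →L[ℂ] FourierAlgebra →L[ℂ] ℂ) {ι : Type*}
    (s : Finset ι) (v : ι → FourierAlgebra) (t w : FourierAlgebra) :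
    diag ψ (∑ i ∈ s, v i) t w = ∑ i ∈ s, diag ψ (v i) t w := by
  rw [← _root_.sum_apply, ← sub_eq_zero, ← _root_.sub_apply]
  have := norm_le_of_norm_chr_le (diag ψ (∑ i ∈ s, v i) t - ∑ i ∈ s, diag ψ (v i) t) (C := 0)
    (fun n => by
      simp only [_root_.sub_apply, _root_.sum_apply, diag_chr,
        Finset.sum_mul, map_sum, sub_self, norm_zero, le_refl]) w
  rw [zero_mul] at this
  exact norm_le_zero_iff.1 this

/-! ### Two cosine series -/

/-- This is the Fourier series of the second Bernoulli polynomial, rescaled to period `2π`. -/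
theorem hasSum_cos_div_sq {s : ℝ} (hs : s ∈ Set.Icc 0 (2 * Real.pi)) :
    HasSum (fun n : ℕ => 1 / (n : ℝ) ^ 2 * Real.cos (n * s))
      (s ^ 2 / 4 - Real.pi * s / 2 + Real.pi ^ 2 / 6) := by
  have hπ := Real.pi_pos
  have h := hasSum_one_div_nat_pow_mul_cos one_ne_zero (x := s / (2 * Real.pi))
    ⟨div_nonneg hs.1 (by positivity), div_le_one_of_le₀ hs.2 (by positivity)⟩
  convert h using 1
  · funext n
    congr 2
    field_simp
  · simp only [Polynomial.bernoulli, Finset.sum_range_succ, Polynomial.map_add,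
      Polynomial.map_monomial, Polynomial.eval_add, Polynomial.eval_monomial, mul_one,
      Finset.sum_range_zero, zero_add]
    norm_num [bernoulli_one, bernoulli_two, Nat.factorial]
    field_simp
    ring

/-- The even-index terms are a quarter of the full series at `2|s|`; subtracting them cancels the
quadratic part and leaves a multiple of `|s|`. -/
theorem hasSum_cos_odd_div_sq {s : ℝ} (hs : |s| ≤ Real.pi) :
    HasSum (fun k : ℕ => 1 / (2 * (k : ℝ) + 1) ^ 2 * Real.cos ((2 * k + 1) * s))
      (Real.pi ^ 2 / 8 - Real.pi * |s| / 4) := by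
  have hf := hasSum_cos_div_sq (s := |s|) ⟨abs_nonneg s, by linarith [Real.pi_pos]⟩
  have he : HasSum (fun k : ℕ => 1 / ((2 * k : ℕ) : ℝ) ^ 2 * Real.cos ((2 * k : ℕ) * |s|))
      (((2 * |s|) ^ 2 / 4 - Real.pi * (2 * |s|) / 2 + Real.pi ^ 2 / 6) / 4) := by
    refine ((hasSum_cos_div_sq (s := 2 * |s|)
      ⟨by positivity, by linarith⟩).div_const 4).congr_fun fun k => ?_
    push_cast
    rw [show 2 * (k : ℝ) * |s| = k * (2 * |s|) by ring, mul_pow]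
    ring
  have ho : Summable (fun k : ℕ => 1 / ((2 * k + 1 : ℕ) : ℝ) ^ 2 *
      Real.cos ((2 * k + 1 : ℕ) * |s|)) :=
    hf.summable.comp_injective (i := fun k : ℕ => 2 * k + 1) fun a b h => by
      simpa using h
  have hu := (HasSum.even_add_odd (f := fun n : ℕ => 1 / (n : ℝ) ^ 2 * Real.cos (n * |s|))
    he ho.hasSum).unique hf
  have hv : ∑' k : ℕ, 1 / ((2 * k + 1 : ℕ) : ℝ) ^ 2 * Real.cos ((2 * k + 1 : ℕ) * |s|) =
      Real.pi ^ 2 / 8 - Real.pi * |s| / 4 := by linear_combination hu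
  rw [← hv]
  refine ho.hasSum.congr_fun fun k => ?_
  have : ((2 * k + 1 : ℕ) : ℝ) * |s| = |(2 * (k : ℝ) + 1) * s| := by
    rw [abs_mul, abs_of_nonneg (show (0 : ℝ) ≤ 2 * k + 1 by positivity)]
    push_cast
    ring
  rw [this, Real.cos_abs]
  push_cast
  rfl

theorem hasSum_one_div_odd_sq :
    HasSum (fun k : ℕ => 1 / (2 * (k : ℝ) + 1) ^ 2) (Real.pi ^ 2 / 8) := by
  simpa using hasSum_cos_odd_div_sq (s := 0) (by simpa using Real.pi_pos.le)

theorem exists_coe_eq (x : Torus) : ∃ s : ℝ, (s : Torus) = x ∧ |s| ≤ Real.pi ∧ ‖x‖ = |s| := by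
  induction x using QuotientAddGroup.induction_on with
  | H z =>
    have hz := AddCircle.norm_eq (2 * Real.pi) (x := z)
    refine ⟨z - round ((2 * Real.pi)⁻¹ * z) * (2 * Real.pi), ?_, ?_, hz⟩
    · rw [AddCircle.coe_sub, ← zsmul_eq_mul, AddCircle.coe_zsmul, AddCircle.coe_period]
      simp
    · rw [← hz]
      refine (AddCircle.norm_le_half_period (2 * Real.pi) Real.two_pi_pos.ne').trans_eq ?_
      rw [abs_of_pos Real.two_pi_pos]
      ring

/-- `x ↦ cos (n x)` as an element of `A(𝕋)`. -/
def cosine (n : ℤ) : FourierAlgebra := (1 / 2 : ℂ) • (chr n + chr (-n))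

theorem norm_cosine_le (n : ℤ) : ‖cosine n‖ ≤ 1 := by
  rw [cosine, norm_smul]
  have := norm_add_le (chr n) (chr (-n))
  rw [norm_chr, norm_chr] at this
  norm_num
  linarith

theorem cosine_apply_coe (n : ℤ) (s : ℝ) : cosine n (s : Torus) = (Real.cos (n * s) : ℂ) := by
  have hf : ∀ m : ℤ, (fourier m (s : Torus) : ℂ) = Complex.exp ((m * s : ℂ) * Complex.I) := by
    intro m
    rw [fourier_coe_apply]
    congr 1
    have : (Real.pi : ℂ) ≠ 0 := by exact_mod_cast Real.pi_ne_zero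
    push_cast
    field_simp
  rw [cosine, ← evalCL_apply, map_smul, map_add, evalCL_apply, evalCL_apply, toC_chr, toC_chr,
    hf, hf, Complex.ofReal_cos, Complex.cos]
  push_cast
  simp only [smul_eq_mul, neg_mul]
  ring

theorem dilate_cosine (N n : ℤ) : dilate N (cosine n) = cosine (N * n) := by
  rw [cosine, map_smul, map_add, dilate_chr, dilate_chr, cosine, mul_neg]

theorem dilate_one (N : ℤ) : dilate N 1 = 1 := by
  rw [← chr_zero, dilate_chr, mul_zero]

theorem norm_one_fourierAlgebra : ‖(1 : FourierAlgebra)‖ = 1 := by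
  rw [← chr_zero, norm_chr]

/-! ### A partition of unity by hat functions -/

/-- The continuous `2π`-periodic function `∑ₙ cos(ns)/n²`. -/
def cosSum (s : ℝ) : ℝ := ∑' n : ℕ, 1 / (n : ℝ) ^ 2 * Real.cos (n * s)

theorem hasSum_cosSum (s : ℝ) :
    HasSum (fun n : ℕ => 1 / (n : ℝ) ^ 2 * Real.cos (n * s)) (cosSum s) := by
  refine Summable.hasSum (Summable.of_norm_bounded hasSum_zeta_two.summable fun n => ?_)
  rw [norm_mul, Real.norm_of_nonneg (show (0 : ℝ) ≤ 1 / (n : ℝ) ^ 2 by positivity)]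
  exact mul_le_of_le_one_right (by positivity) (Real.abs_cos_le_one _)

theorem cosSum_eq {s : ℝ} (h0 : 0 ≤ s) (h1 : s ≤ 2 * Real.pi) :
    cosSum s = s ^ 2 / 4 - Real.pi * s / 2 + Real.pi ^ 2 / 6 :=
  (hasSum_cosSum s).unique (hasSum_cos_div_sq ⟨h0, h1⟩)

theorem cosSum_neg (s : ℝ) : cosSum (-s) = cosSum s := by
  simp only [cosSum, mul_neg, Real.cos_neg]

theorem cosSum_add_two_pi (s : ℝ) : cosSum (s + 2 * Real.pi) = cosSum s := by
  simp only [cosSum, mul_add, Real.cos_add_nat_mul_two_pi]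

/-- The Fourier cosine coefficients of the hat function. -/
def hatCoeff (n : ℕ) : ℝ :=
  16 / Real.pi ^ 2 * (1 / (n : ℝ) ^ 2 * (1 - Real.cos (n * (Real.pi / 8))))

theorem hatCoeff_nonneg (n : ℕ) : 0 ≤ hatCoeff n := by
  have := Real.cos_le_one (n * (Real.pi / 8))
  unfold hatCoeff
  have : 0 ≤ 1 - Real.cos (n * (Real.pi / 8)) := by linarith
  positivity

/-- A second difference with step `π/8` multiplies the `n`-th cosine coefficient by `2(1 -
cos(nπ/8))`; this is why the hat has nonnegative coefficients. The term `n = 0` is zero since `1 / 0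
= 0`. -/
theorem hasSum_hatCoeff_mul_cos (s : ℝ) :
    HasSum (fun n : ℕ => hatCoeff n * Real.cos (n * s))
      (8 / Real.pi ^ 2 * (2 * cosSum s - cosSum (s + Real.pi / 8) - cosSum (s - Real.pi / 8))) := by
  refine ((((hasSum_cosSum s).mul_left 2).sub (hasSum_cosSum (s + Real.pi / 8))).sub
    (hasSum_cosSum (s - Real.pi / 8))).mul_left (8 / Real.pi ^ 2) |>.congr_fun fun n => ?_
  rw [hatCoeff, mul_add, mul_sub (n : ℝ) s, Real.cos_add, Real.cos_sub]
  ring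

theorem hasSum_hatCoeff : HasSum hatCoeff (15 / 16) := by
  have hπ := Real.pi_pos
  have h := hasSum_hatCoeff_mul_cos 0
  rw [zero_add, zero_sub, cosSum_neg, cosSum_eq le_rfl (by positivity),
    cosSum_eq (by positivity) (by linarith)] at h
  convert h using 1
  · funext n; simp
  · field_simp
    ring

/-- The hat function of height `1`, centre `0` and support `[-π/8, π/8]`. -/
def hat : FourierAlgebra :=
  (1 / 16 : ℂ) • (1 : FourierAlgebra) + ∑' n : ℕ, (hatCoeff n : ℂ) • cosine n

theorem norm_hatCoeff_smul_cosine_le (n : ℕ) : ‖(hatCoeff n : ℂ) • cosine n‖ ≤ hatCoeff n := by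
  rw [norm_smul, Complex.norm_real, Real.norm_of_nonneg (hatCoeff_nonneg n)]
  exact mul_le_of_le_one_right (hatCoeff_nonneg n) (norm_cosine_le n)

/-- As all coefficients are nonnegative, their sum `1/16 + 15/16` bounds the norm. -/
theorem norm_hat_le : ‖hat‖ ≤ 1 := by
  refine (norm_add_le _ _).trans ?_
  have h1 := tsum_of_norm_bounded hasSum_hatCoeff norm_hatCoeff_smul_cosine_le
  have h2 : ‖(1 / 16 : ℂ) • (1 : FourierAlgebra)‖ = 1 / 16 := by
    rw [norm_smul, norm_one_fourierAlgebra]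
    norm_num
  rw [h2]
  linarith

theorem one_apply (x : Torus) : (1 : FourierAlgebra) x = 1 := by
  rw [map_one, ContinuousMap.one_apply]

theorem hat_apply_coe (s : ℝ) : hat (s : Torus) = ((1 / 16 +
    8 / Real.pi ^ 2 * (2 * cosSum s - cosSum (s + Real.pi / 8) - cosSum (s - Real.pi / 8)) : ℝ) :
      ℂ) := by
  have hs : Summable fun n : ℕ => (hatCoeff n : ℂ) • cosine n :=
    Summable.of_norm_bounded hasSum_hatCoeff.summable norm_hatCoeff_smul_cosine_le
  have h := (evalCL (s : Torus)).hasSum hs.hasSum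
  have h' : HasSum (fun n : ℕ => (hatCoeff n : ℂ) * (Real.cos (n * s) : ℂ)) _ :=
    h.congr_fun fun n => by
      rw [map_smul, evalCL_apply, cosine_apply_coe, smul_eq_mul, Int.cast_natCast]
  have h2 := (Complex.ofRealCLM.hasSum (hasSum_hatCoeff_mul_cos s))
  simp only [Complex.ofRealCLM_apply, Complex.ofReal_mul (hatCoeff _)] at h2
  rw [← evalCL_apply, hat, map_add, h'.unique h2, map_smul, evalCL_apply, one_apply]
  push_cast
  simp

/-- Away from the peak the three arguments `s`, `s ± π/8` lie in one period, where `cosSum` is a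
single quadratic; its constant second difference cancels the `1/16`. -/
theorem hat_apply_eq_zero {x : Torus} (hx : Real.pi / 8 ≤ ‖x‖) : hat x = 0 := by
  have hπ := Real.pi_pos
  have key : ∀ s : ℝ, Real.pi / 8 ≤ s → s ≤ 2 * Real.pi - Real.pi / 8 →
      hat (s : Torus) = 0 := by
    intro s h1 h2
    rw [hat_apply_coe, Complex.ofReal_eq_zero, cosSum_eq (by linarith) (by linarith),
      cosSum_eq (by linarith) (by linarith), cosSum_eq (by linarith) (by linarith)]
    field_simp
    ring
  obtain ⟨s, rfl, hs, hn⟩ := exists_coe_eq x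
  rw [hn] at hx
  obtain ⟨h1, h2⟩ := abs_le.1 hs
  rcases le_total 0 s with h | h
  · rw [abs_of_nonneg h] at hx
    exact key s hx (by linarith)
  · rw [abs_of_nonpos h] at hx
    have := key (s + 2 * Real.pi) (by linarith) (by linarith)
    rwa [AddCircle.coe_add_period] at this

/-- The second differences telescope over a full period `16 · π/8 = 2π`, leaving sixteen constants
`1/16`. -/
theorem sum_hat_translates (x : Torus) :
    ∑ j ∈ Finset.range 16, hat (x - ((j * (Real.pi / 8) : ℝ) : Torus)) = 1 := by
  have hπ := Real.pi_pos
  obtain ⟨s, rfl, -, -⟩ := exists_coe_eq x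
  set g : ℕ → ℝ := fun j => cosSum (s - j * (Real.pi / 8)) -
    cosSum (s - j * (Real.pi / 8) + Real.pi / 8) with hg
  have h1 : ∀ j : ℕ, hat ((s : Torus) - ((j * (Real.pi / 8) : ℝ) : Torus)) =
      ((1 / 16 - 8 / Real.pi ^ 2 * (g (j + 1) - g j) : ℝ) : ℂ) := by
    intro j
    rw [← AddCircle.coe_sub, hat_apply_coe, hg]
    have e1 : s - ((j + 1 : ℕ) : ℝ) * (Real.pi / 8) = s - j * (Real.pi / 8) - Real.pi / 8 := by
      push_cast; ring
    simp only [e1, sub_add_cancel]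
    congr 1
    ring
  have h2 : g 16 = g 0 := by
    have e1 : s - ((16 : ℕ) : ℝ) * (Real.pi / 8) + 2 * Real.pi = s - (0 : ℕ) * (Real.pi / 8) := by
      push_cast; ring
    have p1 := cosSum_add_two_pi (s - ((16 : ℕ) : ℝ) * (Real.pi / 8))
    have p2 := cosSum_add_two_pi (s - ((16 : ℕ) : ℝ) * (Real.pi / 8) + Real.pi / 8)
    rw [e1] at p1
    rw [add_right_comm, e1] at p2
    simp only [hg]
    rw [p1, p2]
  simp only [h1]
  rw [← Complex.ofReal_sum, Finset.sum_sub_distrib, ← Finset.mul_sum, Finset.sum_range_sub, h2]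
  simp

/-- The hat function centred at `j π/8`. -/
def hatAt (j : ℤ) : FourierAlgebra := translate ((j * (Real.pi / 8) : ℝ) : Torus) hat

theorem norm_hatAt_le (j : ℤ) : ‖hatAt j‖ ≤ 1 := (norm_translate_le _ _).trans norm_hat_le

theorem hatAt_apply (j : ℤ) (x : Torus) :
    hatAt j x = hat (x - ((j * (Real.pi / 8) : ℝ) : Torus)) := translate_apply _ _ _

theorem hatAt_apply_add (a j : ℤ) (x : Torus) :
    hatAt (a + j) x = hatAt j (x - ((a * (Real.pi / 8) : ℝ) : Torus)) := by
  rw [hatAt_apply, hatAt_apply, sub_sub, ← AddCircle.coe_add]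
  push_cast
  rw [add_mul]

theorem sum_hatAt (a : ℤ) : ∑ j ∈ Finset.range 16, hatAt (a + j) = 1 := by
  apply toC_injective
  ext x
  rw [map_sum, ContinuousMap.sum_apply, one_apply,
    ← sum_hat_translates (x - ((a * (Real.pi / 8) : ℝ) : Torus))]
  refine Finset.sum_congr rfl fun j _ => ?_
  rw [hatAt_apply_add, hatAt_apply, Int.cast_natCast]

/-- The sum of the five hat functions nearest to `a π/8`. -/
def plateau (a : ℤ) : FourierAlgebra := ∑ j ∈ Finset.Icc 6 10, hatAt (a - 8 + (j : ℕ))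

theorem norm_one_sub_plateau_le (a : ℤ) : ‖1 - plateau a‖ ≤ 6 := by
  refine (norm_sub_le _ _).trans ?_
  have : ‖plateau a‖ ≤ ∑ j ∈ Finset.Icc 6 10, (1 : ℝ) :=
    norm_sum_le_of_le _ fun j _ => norm_hatAt_le _
  rw [norm_one_fourierAlgebra]
  norm_num at this
  linarith

theorem norm_coe_mul_pi_div {r : ℝ} (hr : |r| ≤ 8) :
    ‖((r * (Real.pi / 8) : ℝ) : Torus)‖ = |r| * (Real.pi / 8) := by
  have hπ := Real.pi_pos
  have e : |r * (Real.pi / 8)| = |r| * (Real.pi / 8) := by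
    rw [abs_mul, abs_of_pos (by positivity : 0 < Real.pi / 8)]
  rw [← e, AddCircle.norm_coe_eq_abs_iff _ Real.two_pi_pos.ne', e, abs_of_pos Real.two_pi_pos]
  nlinarith

theorem hatAt_shift_apply (a : ℤ) (j : ℕ) (x : Torus) :
    hatAt (a - 8 + j) x = hat (x - ((a * (Real.pi / 8) : ℝ) : Torus) -
      ((((j : ℝ) - 8) * (Real.pi / 8) : ℝ) : Torus)) := by
  rw [hatAt_apply, sub_sub, ← AddCircle.coe_add]
  push_cast
  congr 4
  ring

theorem norm_lt_of_plateau_ne_zero {a : ℤ} {y : Torus} (h : plateau a y ≠ 0) :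
    ‖y - ((a * (Real.pi / 8) : ℝ) : Torus)‖ < 3 * (Real.pi / 8) := by
  have hπ := Real.pi_pos
  by_contra! hy
  apply h
  rw [plateau, map_sum, ContinuousMap.sum_apply]
  refine Finset.sum_eq_zero fun j hj => ?_
  rw [hatAt_shift_apply]
  apply hat_apply_eq_zero
  obtain ⟨h1, h2⟩ := Finset.mem_Icc.1 hj
  have h1' : (6 : ℝ) ≤ j := by exact_mod_cast h1
  have h2' : (j : ℝ) ≤ 10 := by exact_mod_cast h2
  have hj' : |(j : ℝ) - 8| ≤ 2 := abs_le.2 ⟨by linarith, by linarith⟩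
  have := norm_sub_norm_le (y - ((a * (Real.pi / 8) : ℝ) : Torus))
    ((((j : ℝ) - 8) * (Real.pi / 8) : ℝ) : Torus)
  rw [norm_coe_mul_pi_div (hj'.trans (by norm_num))] at this
  nlinarith

/-- All sixteen hats sum to `1`, and those omitted have centres at distance at least `3π/8` from
`aπ/8`, so they vanish at `y`. -/
theorem plateau_apply_eq_one {a : ℤ} {y : Torus}
    (h : ‖y - ((a * (Real.pi / 8) : ℝ) : Torus)‖ < 2 * (Real.pi / 8)) : plateau a y = 1 := by
  have hπ := Real.pi_pos
  rw [← one_apply y, ← sum_hatAt (a - 8), plateau, map_sum, map_sum, ContinuousMap.sum_apply,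
    ContinuousMap.sum_apply]
  refine Finset.sum_subset (fun j hj => ?_) fun j hj hj' => ?_
  · simp only [Finset.mem_Icc, Finset.mem_range] at hj ⊢
    omega
  rw [hatAt_shift_apply]
  apply hat_apply_eq_zero
  rw [Finset.mem_range] at hj
  have hj8 : |(j : ℝ) - 8| ≤ 8 := by
    have : (j : ℝ) ≤ 16 := by exact_mod_cast hj.le
    exact abs_le.2 ⟨by linarith [(Nat.cast_nonneg j : (0 : ℝ) ≤ j)], by linarith⟩
  have hj3 : 3 ≤ |(j : ℝ) - 8| := by
    rw [le_abs]
    rw [Finset.mem_Icc, not_and_or] at hj'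
    rcases hj' with hj' | hj'
    · right
      have : (j : ℝ) ≤ 5 := by exact_mod_cast (by omega : j ≤ 5)
      linarith
    · left
      have : (11 : ℝ) ≤ j := by exact_mod_cast (by omega : 11 ≤ j)
      linarith
  have := norm_sub_norm_le ((((j : ℝ) - 8) * (Real.pi / 8) : ℝ) : Torus)
    (y - ((a * (Real.pi / 8) : ℝ) : Torus))
  rw [norm_coe_mul_pi_div hj8, norm_sub_rev _ (y - _)] at this
  nlinarith

theorem norm_lt_of_hatAt_ne_zero {a : ℤ} {x : Torus} (h : hatAt a x ≠ 0) :
    ‖x - ((a * (Real.pi / 8) : ℝ) : Torus)‖ < Real.pi / 8 := by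
  by_contra! hx
  exact h (by rw [hatAt_apply, hat_apply_eq_zero hx])

theorem supp_hatAt_inter_supp_one_sub_plateau (a : ℤ) :
    (hatAt a).supp ∩ (1 - plateau a).supp = ∅ := by
  have hπ := Real.pi_pos
  set c : Torus := ((a * (Real.pi / 8) : ℝ) : Torus) with hc
  have hcont : Continuous fun x : Torus => ‖x - c‖ := by fun_prop
  have h1 : (hatAt a).supp ⊆ {x | ‖x - c‖ ≤ Real.pi / 8} :=
    closure_minimal (fun x hx => (norm_lt_of_hatAt_ne_zero hx).le)
      (isClosed_le hcont continuous_const)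
  have h2 : (1 - plateau a).supp ⊆ {x | 2 * (Real.pi / 8) ≤ ‖x - c‖} := by
    refine closure_minimal (fun x hx => ?_) (isClosed_le continuous_const hcont)
    by_contra hlt
    apply hx
    rw [map_sub, ContinuousMap.sub_apply, one_apply, plateau_apply_eq_one (not_le.1 hlt), sub_self]
  rw [Set.eq_empty_iff_forall_notMem]
  rintro x ⟨hx1, hx2⟩
  have h1' := h1 hx1
  have h2' := h2 hx2
  simp only [Set.mem_ofPred_eq] at h1' h2'
  linarith

/-- A function vanishing on `[-π/2, π/2]` is paired boundedly with the diagonal of `ψ`. -/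
theorem norm_diag_le {α : ℝ} (hα : 0 ≤ α)
    {ψ : FourierAlgebra →L[ℂ] FourierAlgebra →L[ℂ] ℂ} (hψ : DisjointBound α ψ)
    {w : FourierAlgebra} (hw : ∀ x : Torus, ‖x‖ ≤ Real.pi / 2 → w x = 0) :
    ‖diag ψ 1 1 w‖ ≤ 96 * α * ‖w‖ := by
  have hsum : (1 : FourierAlgebra) = ∑ j ∈ Finset.range 16, hatAt j := by
    simpa using (sum_hatAt 0).symm
  have hterm : ∀ a : ℤ, ‖diag ψ (hatAt a) 1 w‖ ≤ 6 * α * ‖w‖ := by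
    intro a
    -- The radii `π/8` of the hat and `3π/8` of the plateau add up to `π/2`.
    refine (norm_diag_one_right_le hα hψ (t := plateau a) (fun x y hx hy => hw _ ?_)
      (supp_hatAt_inter_supp_one_sub_plateau a)).trans ?_
    · have h1 := norm_lt_of_hatAt_ne_zero hx
      have h2 := norm_lt_of_plateau_ne_zero hy
      have h3 := norm_sub_le (x - ((a * (Real.pi / 8) : ℝ) : Torus))
        (y - ((a * (Real.pi / 8) : ℝ) : Torus))
      rw [sub_sub_sub_cancel_right] at h3
      linarith
    · have h1 := norm_hatAt_le a
      have h2 := norm_one_sub_plateau_le a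
      calc α * ‖hatAt a‖ * ‖1 - plateau a‖ * ‖w‖ ≤ α * 1 * 6 * ‖w‖ := by gcongr
        _ = 6 * α * ‖w‖ := by ring
  calc ‖diag ψ 1 1 w‖ = ‖∑ j ∈ Finset.range 16, diag ψ (hatAt j) 1 w‖ := by
        rw [← diag_sum_left, ← hsum]
    _ ≤ ∑ j ∈ Finset.range 16, 6 * α * ‖w‖ := norm_sum_le_of_le _ fun j _ => hterm j
    _ = 96 * α * ‖w‖ := by rw [Finset.sum_const, Finset.card_range, nsmul_eq_mul]; push_cast; ring

/-! ### The triangle function and its dyadic self-similarity -/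

/-- The Fourier coefficient weights of the triangle function. -/
def oddWeight (k : ℕ) : ℝ := 1 / (2 * (k : ℝ) + 1) ^ 2

theorem oddWeight_nonneg (k : ℕ) : 0 ≤ oddWeight k := by unfold oddWeight; positivity

theorem hasSum_oddWeight : HasSum oddWeight (Real.pi ^ 2 / 8) := hasSum_one_div_odd_sq

theorem norm_one_sub_cosine_le (n : ℤ) : ‖1 - cosine n‖ ≤ 2 := by
  refine (norm_sub_le _ _).trans ?_
  rw [norm_one_fourierAlgebra]
  linarith [norm_cosine_le n]

theorem norm_oddWeight_smul_le (k : ℕ) {f : FourierAlgebra} (hf : ‖f‖ ≤ 2) :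
    ‖(oddWeight k : ℂ) • f‖ ≤ oddWeight k * 2 := by
  rw [norm_smul, Complex.norm_real, Real.norm_of_nonneg (oddWeight_nonneg k)]
  exact mul_le_mul_of_nonneg_left hf (oddWeight_nonneg k)

/-- The function equal to `π|s|/4` on `[-π, π]`. -/
def triangle : FourierAlgebra := ∑' k : ℕ, (oddWeight k : ℂ) • (1 - cosine (2 * k + 1))

theorem hasSum_triangle :
    HasSum (fun k : ℕ => (oddWeight k : ℂ) • (1 - cosine (2 * k + 1))) triangle :=
  (Summable.of_norm_bounded (hasSum_oddWeight.summable.mul_right 2) fun k =>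
    norm_oddWeight_smul_le k (norm_one_sub_cosine_le _)).hasSum

theorem triangle_apply_coe {s : ℝ} (hs : |s| ≤ Real.pi) :
    triangle (s : Torus) = (Real.pi * |s| / 4 : ℝ) := by
  have h1 := Complex.ofRealCLM.hasSum (hasSum_one_div_odd_sq.sub (hasSum_cos_odd_div_sq hs))
  rw [sub_sub_cancel] at h1
  refine ((evalCL (s : Torus)).hasSum hasSum_triangle).unique (h1.congr_fun fun k => ?_)
  rw [map_smul, map_sub, evalCL_apply, evalCL_apply, cosine_apply_coe, one_apply,
    Complex.ofRealCLM_apply, oddWeight]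
  push_cast
  rw [smul_eq_mul]
  ring

/-- The part of the triangle function living away from the origin. -/
def triangleFar : FourierAlgebra := triangle - (1 / 2 : ℂ) • dilate 2 triangle

theorem triangleFar_apply_eq_zero (x : Torus) (hx : ‖x‖ ≤ Real.pi / 2) : triangleFar x = 0 := by
  have hπ := Real.pi_pos
  obtain ⟨s, rfl, hs, hn⟩ := exists_coe_eq x
  rw [hn] at hx
  have h2 : |2 * s| ≤ Real.pi := by rw [abs_mul, abs_two]; linarith
  have e : ((2 : ℤ) • (s : Torus)) = ((2 * s : ℝ) : Torus) := by
    rw [← AddCircle.coe_zsmul, zsmul_eq_mul]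
    norm_num
  rw [triangleFar, ← evalCL_apply, map_sub, map_smul, evalCL_apply, evalCL_apply, dilate_apply, e,
    triangle_apply_coe hs, triangle_apply_coe h2, abs_mul, abs_two, smul_eq_mul]
  push_cast
  ring

/-- Combining the constants termwise before estimating gives `1/2 + 1 + 1/2 = 2` per weight. -/
theorem norm_triangleFar_le : ‖triangleFar‖ ≤ Real.pi ^ 2 / 4 := by
  have h := hasSum_triangle.sub (((dilate 2).hasSum hasSum_triangle).const_smul (1 / 2 : ℂ))
  have hb := h.norm_le_of_bounded (hasSum_oddWeight.mul_right 2) (fun k => ?_)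
  · refine hb.trans_eq ?_
    ring
  have e : (oddWeight k : ℂ) • (1 - cosine (2 * k + 1)) -
      (1 / 2 : ℂ) • dilate 2 ((oddWeight k : ℂ) • (1 - cosine (2 * k + 1))) =
      (oddWeight k : ℂ) • ((1 / 2 : ℂ) • 1 - cosine (2 * k + 1) +
        (1 / 2 : ℂ) • cosine (2 * (2 * k + 1))) := by
    rw [map_smul, map_sub, dilate_one, dilate_cosine]
    module
  rw [e]
  refine norm_oddWeight_smul_le k ?_
  refine (norm_add_le _ _).trans ?_
  have h1 := norm_sub_le ((1 / 2 : ℂ) • (1 : FourierAlgebra)) (cosine (2 * k + 1))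
  have h2 := norm_cosine_le (2 * k + 1)
  have h3 := norm_cosine_le (2 * (2 * k + 1))
  have h4 : ‖(1 / 2 : ℂ)‖ = 1 / 2 := by norm_num
  rw [norm_smul, h4, norm_one_fourierAlgebra] at h1
  rw [norm_smul, h4]
  linarith

/-! ### Self-improving estimates -/

/-- Apply the hypothesis with `P` the supremum and solve for it. The crude bound `M` only makes the
supremum finite and leaves no trace in the result; this is the sole role of `B` in `IsAdmissible`.
-/
theorem le_of_self_improving {ι : Type*} {F : ι → ℝ} {M θ c : ℝ} (hM : ∀ i, F i ≤ M) (hθ : θ < 1)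
    (h : ∀ P, (∀ i, F i ≤ P) → ∀ i, F i ≤ θ * P + c) (i : ι) : F i ≤ c / (1 - θ) := by
  have : Nonempty ι := ⟨i⟩
  have hb : BddAbove (Set.range F) := ⟨M, by rintro _ ⟨i, rfl⟩; exact hM i⟩
  have hs : ⨆ i, F i ≤ θ * (⨆ i, F i) + c := ciSup_le (h _ fun i => le_ciSup hb i)
  refine (le_ciSup hb i).trans ?_
  rw [le_div_iff₀ (by linarith)]
  linarith

/-- Bilinear forms bounded by `α` on pairs with disjoint supports and by `B` on characters. -/
def IsAdmissible (α B : ℝ) (ψ : FourierAlgebra →L[ℂ] FourierAlgebra →L[ℂ] ℂ) : Prop :=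
  DisjointBound α ψ ∧ ∀ m n : ℤ, ‖ψ (chr m) (chr n)‖ ≤ B

/-- `ψ(f(N ·), g(N ·))`. -/
def dilateForm (N : ℤ) (ψ : FourierAlgebra →L[ℂ] FourierAlgebra →L[ℂ] ℂ) :
    FourierAlgebra →L[ℂ] FourierAlgebra →L[ℂ] ℂ :=
  ψ.bilinearComp (dilate N) (dilate N)

/-- `ψ(e_k f, e_l g)`. -/
def twistForm (k l : ℤ) (ψ : FourierAlgebra →L[ℂ] FourierAlgebra →L[ℂ] ℂ) :
    FourierAlgebra →L[ℂ] FourierAlgebra →L[ℂ] ℂ :=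
  ψ.bilinearComp (ContinuousLinearMap.mul ℂ FourierAlgebra (chr k))
    (ContinuousLinearMap.mul ℂ FourierAlgebra (chr l))

theorem dilateForm_apply (N : ℤ) (ψ : FourierAlgebra →L[ℂ] FourierAlgebra →L[ℂ] ℂ)
    (f g : FourierAlgebra) : dilateForm N ψ f g = ψ (dilate N f) (dilate N g) := rfl

theorem twistForm_apply (k l : ℤ) (ψ : FourierAlgebra →L[ℂ] FourierAlgebra →L[ℂ] ℂ)
    (f g : FourierAlgebra) : twistForm k l ψ f g = ψ (chr k * f) (chr l * g) := rfl

variable {α B : ℝ} {ψ : FourierAlgebra →L[ℂ] FourierAlgebra →L[ℂ] ℂ}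

theorem IsAdmissible.dilateForm (hα : 0 ≤ α) (h : IsAdmissible α B ψ) (N : ℤ) :
    IsAdmissible α B (dilateForm N ψ) := by
  refine ⟨fun f g hfg => ?_, fun m n => ?_⟩
  · rw [dilateForm_apply]
    refine (h.1 _ _ ?_).trans ?_
    · rw [← Set.subset_empty_iff]
      refine (Set.inter_subset_inter (supp_dilate_subset N f) (supp_dilate_subset N g)).trans ?_
      rw [← Set.preimage_inter, hfg, Set.preimage_empty]
    · gcongr
      · exact norm_dilate_le N f
      · exact norm_dilate_le N g
  · rw [dilateForm_apply, dilate_chr, dilate_chr]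
    exact h.2 _ _

theorem IsAdmissible.twistForm (hα : 0 ≤ α) (h : IsAdmissible α B ψ) (k l : ℤ) :
    IsAdmissible α B (twistForm k l ψ) := by
  refine ⟨fun f g hfg => ?_, fun m n => ?_⟩
  · rw [twistForm_apply, mul_comm _ f, mul_comm _ g]
    refine (h.1 _ _ ?_).trans ?_
    · rw [← Set.subset_empty_iff, ← hfg]
      exact Set.inter_subset_inter (supp_mul_subset_left _ _) (supp_mul_subset_left _ _)
    · gcongr
      · exact norm_mul_chr_le f k
      · exact norm_mul_chr_le g l
  · rw [twistForm_apply, ← chr_add, ← chr_add]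
    exact h.2 _ _

theorem diag_one_chr (ψ : FourierAlgebra →L[ℂ] FourierAlgebra →L[ℂ] ℂ) (n : ℤ) :
    diag ψ 1 1 (chr n) = ψ (chr n) (chr (-n)) := by
  rw [diag_chr, one_mul, one_mul]

theorem IsAdmissible.norm_diag_le (h : IsAdmissible α B ψ) (f : FourierAlgebra) :
    ‖diag ψ 1 1 f‖ ≤ B * ‖f‖ :=
  norm_le_of_norm_chr_le _ (fun n => by rw [diag_one_chr]; exact h.2 _ _) f

theorem diag_dilate (ψ : FourierAlgebra →L[ℂ] FourierAlgebra →L[ℂ] ℂ) (N : ℤ)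
    (f : FourierAlgebra) : diag ψ 1 1 (dilate N f) = diag (dilateForm N ψ) 1 1 f := by
  have := norm_le_of_norm_chr_le ((diag ψ 1 1).comp (dilate N) - diag (dilateForm N ψ) 1 1)
    (C := 0) (fun n => by
      rw [_root_.sub_apply, ContinuousLinearMap.comp_apply, dilate_chr, diag_one_chr,
        diag_one_chr, dilateForm_apply, dilate_chr, dilate_chr, mul_neg, sub_self, norm_zero]) f
  rw [zero_mul] at this
  exact sub_eq_zero.1 (norm_le_zero_iff.1 this)

/-- The triangle is half its dilate by `2` plus `triangleFar`, which contributes at most `96 α ·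
π²/4 = 24π²α`; the contraction factor `1/2` doubles this. -/
theorem norm_diag_triangle_le (hα : 0 ≤ α) (h : IsAdmissible α B ψ) :
    ‖diag ψ 1 1 triangle‖ ≤ 48 * Real.pi ^ 2 * α := by
  have key := le_of_self_improving (ι := {ψ // IsAdmissible α B ψ})
    (F := fun ψ => ‖diag ψ.1 1 1 triangle‖) (M := B * ‖triangle‖) (θ := 1 / 2)
    (c := 24 * Real.pi ^ 2 * α) (fun ψ => ψ.2.norm_diag_le _) (by norm_num)
    (fun P hP ψ => ?_) ⟨ψ, h⟩
  · refine key.trans_eq ?_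
    ring
  have e : triangle = (1 / 2 : ℂ) • dilate 2 triangle + triangleFar := by
    rw [triangleFar, add_sub_cancel]
  have hd := hP ⟨_, ψ.2.dilateForm hα 2⟩
  have hw := FourierAlgebra.norm_diag_le hα ψ.2.1 triangleFar_apply_eq_zero
  have hn : 96 * α * ‖triangleFar‖ ≤ 96 * α * (Real.pi ^ 2 / 4) := by
    gcongr
    exact norm_triangleFar_le
  have e' : diag ψ.1 1 1 triangle = (1 / 2 : ℂ) • diag (FourierAlgebra.dilateForm 2 ψ.1) 1 1
      triangle + diag ψ.1 1 1 triangleFar := by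
    rw [← diag_dilate, ← map_smul, ← map_add, ← e]
  change ‖diag ψ.1 1 1 triangle‖ ≤ _
  rw [e']
  refine (norm_add_le _ _).trans ?_
  have h4 : ‖(1 / 2 : ℂ)‖ = 1 / 2 := by norm_num
  rw [norm_smul, h4]
  linarith

/-- In the series of the triangle the term `k = 0` has weight `1`, and the others are dilates of it
with total weight `π²/8 - 1 < 1`. -/
theorem norm_diag_one_sub_cosine_le (hα : 0 ≤ α) (h : IsAdmissible α B ψ) :
    ‖diag ψ 1 1 (1 - cosine 1)‖ ≤ 48 * Real.pi ^ 2 * α / (2 - Real.pi ^ 2 / 8) := by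
  have hπ : Real.pi ^ 2 / 8 < 2 := by
    have := Real.pi_lt_d2
    nlinarith [Real.pi_pos]
  have key := le_of_self_improving (ι := {ψ // IsAdmissible α B ψ})
    (F := fun ψ => ‖diag ψ.1 1 1 (1 - cosine 1)‖) (M := B * ‖1 - cosine 1‖)
    (θ := Real.pi ^ 2 / 8 - 1) (c := 48 * Real.pi ^ 2 * α) (fun ψ => ψ.2.norm_diag_le _)
    (by linarith) (fun P hP ψ => ?_) ⟨ψ, h⟩
  · refine key.trans_eq ?_
    congr 1
    ring
  have hs := (diag ψ.1 1 1).hasSum hasSum_triangle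
  have hs' := (hasSum_nat_add_iff' 1).2 hs
  have hw' := (hasSum_nat_add_iff' 1).2 hasSum_oddWeight
  have hb := hs'.norm_le_of_bounded (hw'.mul_right P) (fun k => ?_)
  · simp only [Finset.sum_range_one, oddWeight, Nat.cast_zero, mul_zero, zero_add, one_pow,
      div_one, Complex.ofReal_one, one_smul] at hb
    have hg := norm_diag_triangle_le hα ψ.2
    have ht := norm_sub_norm_le (diag ψ.1 1 1 (1 - cosine 1)) (diag ψ.1 1 1 triangle)
    rw [norm_sub_rev] at ht
    linarith
  have e : (1 : FourierAlgebra) - cosine (2 * (k + 1 : ℕ) + 1) =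
      dilate (2 * (k + 1 : ℕ) + 1) (1 - cosine 1) := by
    rw [map_sub, dilate_one, dilate_cosine, mul_one]
  rw [map_smul, norm_smul, Complex.norm_real, Real.norm_of_nonneg (oddWeight_nonneg _), e,
    diag_dilate]
  exact mul_le_mul_of_nonneg_left (hP ⟨_, ψ.2.dilateForm hα _⟩) (oddWeight_nonneg _)

theorem diag_twistForm (ψ : FourierAlgebra →L[ℂ] FourierAlgebra →L[ℂ] ℂ) (k n : ℤ) :
    diag (twistForm k (-k) ψ) 1 1 (chr n) = diag ψ 1 1 (chr (k + n)) := by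
  rw [diag_one_chr, diag_one_chr, twistForm_apply, ← chr_add, ← chr_add, neg_add]

/-- Uses `e_1 - e_0 = (e_2 - e_0)/2 + e_1(1 - cos)`: the first part is a dilate, the second a twist
of the preceding estimate. -/
theorem norm_diag_chr_one_sub_chr_zero_le (hα : 0 ≤ α) (h : IsAdmissible α B ψ) :
    ‖diag ψ 1 1 (chr 1 - chr 0)‖ ≤ 96 * Real.pi ^ 2 * α / (2 - Real.pi ^ 2 / 8) := by
  have key := le_of_self_improving (ι := {ψ // IsAdmissible α B ψ})
    (F := fun ψ => ‖diag ψ.1 1 1 (chr 1 - chr 0)‖) (M := B * ‖chr 1 - chr 0‖) (θ := 1 / 2)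
    (c := 48 * Real.pi ^ 2 * α / (2 - Real.pi ^ 2 / 8)) (fun ψ => ψ.2.norm_diag_le _)
    (by norm_num) (fun P hP ψ => ?_) ⟨ψ, h⟩
  · refine key.trans_eq ?_
    ring
  have hd := hP ⟨_, ψ.2.dilateForm hα 2⟩
  have hc := norm_diag_one_sub_cosine_le hα (ψ.2.twistForm hα 1 (-1))
  have e : diag ψ.1 1 1 (chr 1 - chr 0) =
      (1 / 2 : ℂ) * diag (FourierAlgebra.dilateForm 2 ψ.1) 1 1 (chr 1 - chr 0) +
        diag (FourierAlgebra.twistForm 1 (-1) ψ.1) 1 1 (1 - cosine 1) := by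
    have e0 : (1 : FourierAlgebra) - cosine 1 = chr 0 - (1 / 2 : ℂ) • (chr 1 + chr (-1)) := by
      rw [cosine, chr_zero]
    rw [← diag_dilate, e0]
    simp only [map_sub, map_smul, map_add, dilate_chr, diag_twistForm, smul_eq_mul]
    norm_num
    ring
  rw [e]
  refine (norm_add_le _ _).trans ?_
  have h4 : ‖(1 / 2 : ℂ)‖ = 1 / 2 := by norm_num
  rw [norm_mul, h4]
  linarith

/-! ### The constant, and passage from characters to general elements -/

theorem ninety_six_mul_pi_sq_div_le : 96 * Real.pi ^ 2 / (2 - Real.pi ^ 2 / 8) ≤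
    288 * Real.pi * (1 + Real.sqrt 2) := by
  have hπ := Real.pi_pos
  have h2 := Real.pi_lt_d2
  have hsq : Real.pi ^ 2 < 10 := by nlinarith
  have h1 : 1 ≤ Real.sqrt 2 := Real.one_le_sqrt.2 (by norm_num)
  rw [div_le_iff₀ (by linarith)]
  have h3 : 3 / 4 ≤ 2 - Real.pi ^ 2 / 8 := by linarith
  calc 96 * Real.pi ^ 2 = 96 * Real.pi * Real.pi := by ring
    _ ≤ 96 * Real.pi * (3 * (1 + 1) * (3 / 4)) := by gcongr; linarith
    _ ≤ 96 * Real.pi * (3 * (1 + Real.sqrt 2) * (2 - Real.pi ^ 2 / 8)) := by gcongr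
    _ = _ := by ring

theorem norm_apply_chr_sub_le (hα : 0 ≤ α) (h : DisjointBound α ψ) (a b c : ℤ) :
    ‖ψ (chr a * chr b) (chr c) - ψ (chr a) (chr b * chr c)‖ ≤
      288 * Real.pi * (1 + Real.sqrt 2) * α := by
  have hadm : IsAdmissible α ‖ψ‖ ψ := ⟨h, fun m n => by
    simpa [norm_chr] using ψ.le_opNorm₂ (chr m) (chr n)⟩
  -- For this form the value at `e_1` is `ψ(e_{a+b}, e_c)` and at `e_0` it is `ψ(e_a, e_{b+c})`.
  have hb := norm_diag_chr_one_sub_chr_zero_le hα ((hadm.twistForm hα a (b + c)).dilateForm hα b)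
  have e : diag (dilateForm b (twistForm a (b + c) ψ)) 1 1 (chr 1 - chr 0) =
      ψ (chr a * chr b) (chr c) - ψ (chr a) (chr b * chr c) := by
    rw [map_sub, diag_one_chr, diag_one_chr]
    simp only [dilateForm_apply, twistForm_apply, dilate_chr, ← chr_add]
    congr 3 <;> ring_nf
  rw [e] at hb
  refine hb.trans ?_
  rw [mul_div_right_comm]
  exact mul_le_mul_of_nonneg_right ninety_six_mul_pi_sq_div_le hα

theorem norm_apply_sub_le (hα : 0 ≤ α) (hψ : DisjointBound α ψ) (f g h : FourierAlgebra) :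
    ‖ψ (f * g) h - ψ f (g * h)‖ ≤
      288 * Real.pi * (1 + Real.sqrt 2) * α * ‖f‖ * ‖g‖ * ‖h‖ := by
  let M := ContinuousLinearMap.mul ℂ FourierAlgebra
  set C := 288 * Real.pi * (1 + Real.sqrt 2) * α with hC
  have h1 : ∀ (a b : ℤ) (h : FourierAlgebra),
      ‖ψ (chr a * chr b) h - ψ (chr a) (chr b * h)‖ ≤ C * ‖h‖ := fun a b h =>
    norm_le_of_norm_chr_le (ψ (chr a * chr b) - (ψ (chr a)).comp (M (chr b)))
      (fun c => norm_apply_chr_sub_le hα hψ a b c) h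
  have h2 : ∀ (a : ℤ) (g h : FourierAlgebra),
      ‖ψ (chr a * g) h - ψ (chr a) (g * h)‖ ≤ C * ‖h‖ * ‖g‖ := fun a g h =>
    norm_le_of_norm_chr_le ((ψ.flip h).comp (M (chr a)) - (ψ (chr a)).comp (M.flip h))
      (fun b => h1 a b h) g
  have h3 : ‖ψ (f * g) h - ψ f (g * h)‖ ≤ C * ‖h‖ * ‖g‖ * ‖f‖ :=
    norm_le_of_norm_chr_le ((ψ.flip h).comp (M.flip g) - ψ.flip (g * h))
      (fun a => h2 a g h) f
  refine h3.trans_eq ?_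
  ring

end FourierAlgebra

end

/-! ### The scalar estimate and strong property (B) -/

theorem mainTheorem1 :
    (∀ (φ : FourierAlgebra →L[ℂ] FourierAlgebra →L[ℂ] ℂ) (α : ℝ), 0 ≤ α →
      (∀ f g : FourierAlgebra, f.supp ∩ g.supp = ∅ → ‖φ f g‖ ≤ α * ‖f‖ * ‖g‖) →
      ∀ f g h : FourierAlgebra,
        ‖φ (f * g) h - φ f (g * h)‖
          ≤ 288 * Real.pi * (1 + Real.sqrt 2) * α * ‖f‖ * ‖g‖ * ‖h‖) ∧
    HasStrongPropertyB.{u, 0} FourierAlgebra (288 * Real.pi * (1 + Real.sqrt 2)) := by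
  refine ⟨fun φ α hα h => FourierAlgebra.norm_apply_sub_le hα h, ?_, ?_⟩
  · have := Real.pi_pos
    positivity
  intro X _ _ _ φ α hα hφ a b c
  -- A Hahn–Banach functional of norm at most `1` norming the difference reduces to scalar forms;
  -- disjoint supports force the product to be zero, so the hypothesis on `φ` applies.
  obtain ⟨ξ, hξ, hval⟩ := exists_dual_vector'' ℂ (φ (a * b) c - φ a (b * c))
  have hle : ∀ x, ‖ξ x‖ ≤ ‖x‖ := fun x => by
    simpa using ξ.le_of_opNorm_le hξ x
  have key := FourierAlgebra.norm_apply_sub_le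
    (ψ := (ContinuousLinearMap.compL ℂ FourierAlgebra X ℂ ξ).comp φ) hα
    (fun f g hfg => (hle _).trans (hφ f g (FourierAlgebra.mul_eq_zero_of_supp_disjoint hfg))) a b c
  simp only [ContinuousLinearMap.comp_apply, ContinuousLinearMap.compL_apply] at key
  rw [← map_sub, hval] at key
  simpa using key
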